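/- Let $0<q\le 2$. Suppose $X_1,\dots,X_k$ are jointly symmetric $q$-stable real random variables on a probability space, i.e. there are $n$, vectors $\xi_1,\dots,\xi_k\in\mathbb R^n$, functions $s_1,\dots,s_n\in L_q([0,1])$ and a random vector $Y$ in $\mathbb R^n$ with characteristic function $$\mathbb E\,e^{i(Y,\theta)}=\exp\Big(-\Big\|\sum_{i=1}^n\theta_i s_i\Big\|_{L_q([0,1])}^q\Big),\qquad \theta\in\mathbb R^n,$$ such that $X_1=(Y,\xi_1),\dots,X_k=(Y,\xi_k)$ almost surely. Then for every $m<k$ and all even continuous positive definite functions $f$ on $\mathbb R^m$ and $g$ on $\mathbb R^{k-m}$, the random variables $f(X_1,\dots,X_m)$ and $g(X_{m+1},\dots,X_k)$ are non-negatively correlated: $f(X_1,\dots,X_m)$, $g(X_{m+1},\dots,X_k)$ and their product are integrable, and $$\mathbb E\big(f(X_1,\dots,X_m)\,g(X_{m+1},\dots,X_k)\big)\ \ge\ \mathbb E f(X_1,\dots,X_m)\;\mathbb E g(X_{m+1},\dots,X_k).$$ Here a function $f:\mathbb R^d\to\mathbb C$ is positive definite if $\sum_{i,j}c_i\overline{c_j}f(x_i-x_j)\ge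 0$ for all finite families $x_i\in\mathbb R^d$, $c_i\in\mathbb C$; an even positive definite function is automatically real-valued. -/

import Mathlib

open MeasureTheory Complex

open scoped ComplexOrder ComplexConjugate

namespace StableCorrelation

/-- A complex-valued function `f` on an additive group is positive definite if
`∑ᵢ ∑ⱼ cᵢ * conj cⱼ * f (xᵢ - xⱼ)` is a nonnegative real number for all finite families of points
`xᵢ` and complex scalars `cᵢ`. (In the order on `ℂ`, `0 ≤ z` means that `z` is real and
nonnegative.) -/
def IsPositiveDefinite {E : Type*} [AddGroup E] (f : E → ℂ) : Prop :=
  ∀ (N : ℕ) (x : Fin N → E) (c : Fin N → ℂ),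
    0 ≤ ∑ i, ∑ j, c i * conj (c j) * f (x i - x j)

/-- The space `L_q([0,1])` of real-valued functions, with Lebesgue measure. For every `q > 0`, its
elements carry `‖s‖ = (∫₀¹ |s t| ^ q dt) ^ (1 / q)`, a norm for `q ≥ 1` and a quasi-norm for
`q < 1`. -/
abbrev LqUnitInterval (q : ℝ) : Type :=
  Lp ℝ (ENNReal.ofReal q) (volume.restrict (Set.Icc (0 : ℝ) 1))

variable {Ω : Type*} [MeasurableSpace Ω]

/-- `Y` is a symmetric `q`-stable random vector in `ℝⁿ`: for some `s₁, …, sₙ ∈ L_q([0,1])`, its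
characteristic function is `θ ↦ exp (-‖∑ᵢ θᵢ sᵢ‖ ^ q)`. -/
def IsSymmStableVector (q : ℝ) (P : Measure Ω) {n : ℕ} (Y : Ω → EuclideanSpace ℝ (Fin n)) : Prop :=
  AEMeasurable Y P ∧
    ∃ s : Fin n → LqUnitInterval q, ∀ θ : EuclideanSpace ℝ (Fin n),
      charFun (P.map Y) θ = (Real.exp (-(‖∑ i, θ i • s i‖ ^ q)) : ℂ)

/-- `X₁, …, X_k` are jointly symmetric `q`-stable: for some `n`, they are (almost surely) the inner
products `(Y, ξ₁), …, (Y, ξ_k)` of a symmetric `q`-stable random vector `Y` in `ℝⁿ` with vectors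
`ξ₁, …, ξ_k ∈ ℝⁿ`. -/
def IsJointlySymmStable (q : ℝ) (P : Measure Ω) {k : ℕ} (X : Fin k → Ω → ℝ) : Prop :=
  ∃ (n : ℕ) (Y : Ω → EuclideanSpace ℝ (Fin n)) (ξ : Fin k → EuclideanSpace ℝ (Fin n)),
    IsSymmStableVector q P Y ∧ ∀ i, ∀ᵐ ω ∂P, X i ω = inner ℝ (Y ω) (ξ i)

/-- The vector `(X₁, …, X_m)`. -/
def firstBlock {k m : ℕ} (hmk : m < k) (X : Fin k → Ω → ℝ) (ω : Ω) : Fin m → ℝ :=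
  fun i => X (Fin.castLE hmk.le i) ω

/-- The vector `(X_{m+1}, …, X_k)`. -/
def lastBlock {k m : ℕ} (hmk : m < k) (X : Fin k → Ω → ℝ) (ω : Ω) : Fin (k - m) → ℝ :=
  fun j => X ⟨m + j, by omega⟩ ω

end StableCorrelation

/-!
The composition of a positive definite function with an additive map is positive definite, so both
functions may be pulled back to the space `E = ℝⁿ` of the stable vector `Y`. If these pullbacks are
the characteristic functions of finite measures `μ` and `ν`, and `r` is the characteristic function
of `Y`, then by Parseval the expectation of the product is `∫∫ r (x + y) dμ dν` and the product of
the expectations is `∫∫ r x * r y dμ dν`. Evenness makes `ν` symmetric, so the former is also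
`∫∫ (r (x + y) + r (x - y)) / 2 dμ dν`, and it suffices that
`r x * r y ≤ (r (x + y) + r (x - y)) / 2` (`integral_mul_integral_le_of_charFun`). For
`r = exp (-‖·‖_q ^ q)` this is the arithmetic-geometric mean inequality together with
`‖a + b‖_q ^ q + ‖a - b‖_q ^ q ≤ 2 ‖a‖_q ^ q + 2 ‖b‖_q ^ q`, which holds for `0 < q ≤ 2`
(`LqUnitInterval.norm_add_rpow_add_norm_sub_rpow_le`).

That positive definite functions are characteristic functions is Bochner's theorem. It is only
needed, and only proved here, after multiplication by a Gaussian
(`IsPositiveDefinite.exists_charFun_eq_gaussian_smul`): the product is integrable, positive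
definiteness makes its Fourier transform nonnegative
(`IsPositiveDefinite.fourier_gaussian_smul_nonneg`), nonnegativity makes the Fourier transform
integrable (`integrable_fourier_of_nonneg`), and Fourier inversion exhibits it as the density of the
measure. The Gaussians are then widened to `1` by dominated convergence, which applies because an
even positive definite function is bounded by its value at `0`.
-/

namespace StableCorrelation

open Filter Topology ProbabilityTheory

/-! ### Positive definite functions and their integral form -/

section PositiveDefinite

variable {E : Type*} [AddCommGroup E] {f : E → ℂ}

lemma IsPositiveDefinite.zero_nonneg (hf : IsPositiveDefinite f) : 0 ≤ f 0 := by
  simpa using hf 1 (fun _ => 0) (fun _ => 1)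

lemma IsPositiveDefinite.add_nonneg_of_even (hf : IsPositiveDefinite f) (he : Function.Even f)
    (x : E) (ε : ℝ) (hε : ε ^ 2 = 1) : 0 ≤ f 0 + ε * f x := by
  have h := hf 2 ![x, 0] ![1, (ε : ℂ)]
  have hε' : (ε : ℂ) * ε = 1 := by
    rw [← pow_two]
    exact_mod_cast hε
  simp only [Fin.sum_univ_two, Matrix.cons_val_zero, Matrix.cons_val_one, map_one, conj_ofReal,
    sub_self, sub_zero, zero_sub, he x, hε', one_mul, mul_one] at h
  have h2 : 0 ≤ (2 : ℂ) * (f 0 + ε * f x) := by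
    convert h using 1
    ring
  have h3 := mul_nonneg (show (0 : ℂ) ≤ ((1 / 2 : ℝ) : ℂ) by exact_mod_cast (by norm_num)) h2
  convert h3 using 1
  push_cast
  ring

lemma IsPositiveDefinite.im_eq_zero_of_even (hf : IsPositiveDefinite f) (he : Function.Even f)
    (x : E) : (f x).im = 0 := by
  have h0 := (Complex.nonneg_iff.1 hf.zero_nonneg).2
  have h1 := (Complex.nonneg_iff.1 (hf.add_nonneg_of_even he x 1 (by norm_num))).2
  simp at h1
  linarith

/-- An even positive definite function is bounded by its value at `0`. -/
lemma IsPositiveDefinite.norm_le_of_even (hf : IsPositiveDefinite f) (he : Function.Even f)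
    (x : E) : ‖f x‖ ≤ (f 0).re := by
  have h1 := (Complex.nonneg_iff.1 (hf.add_nonneg_of_even he x 1 (by norm_num))).1
  have h2 := (Complex.nonneg_iff.1 (hf.add_nonneg_of_even he x (-1) (by norm_num))).1
  simp at h1 h2
  have h3 : f x = ((f x).re : ℂ) := by
    apply Complex.ext <;> simp [hf.im_eq_zero_of_even he x]
  rw [h3, norm_real, Real.norm_eq_abs, abs_le]
  constructor <;> linarith

lemma IsPositiveDefinite.comp_addMonoidHom {F : Type*} [AddCommGroup F] {f : F → ℂ}
    (hf : IsPositiveDefinite f) (A : E →+ F) : IsPositiveDefinite (fun x => f (A x)) := by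
  intro N x c
  simpa using hf N (fun i => A (x i)) c

end PositiveDefinite

lemma nonneg_of_forall_nat {a B : ℂ}
    (h : ∀ N : ℕ, 0 ≤ (N : ℂ) * a + (N : ℂ) * ((N : ℂ) - 1) * B) : 0 ≤ B := by
  -- The hypothesis for `N = n + 2`, divided by `N (N - 1)`.
  have h1 : ∀ n : ℕ, 0 ≤ a * (((1 : ℝ) / ((n : ℝ) + 1) : ℝ) : ℂ) + B := by
    intro n
    have h2 := h (n + 2)
    have h3 : (0 : ℂ) ≤ ((1 / (((n : ℝ) + 2) * ((n : ℝ) + 1)) : ℝ) : ℂ) := by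
      exact_mod_cast (by positivity)
    have h4 := mul_nonneg h3 h2
    convert h4 using 1
    have h5 : (n : ℂ) + 1 ≠ 0 := by exact_mod_cast (by positivity : (n : ℝ) + 1 ≠ 0)
    have h6 : (n : ℂ) + 2 ≠ 0 := by exact_mod_cast (by positivity : (n : ℝ) + 2 ≠ 0)
    push_cast
    field_simp
    ring
  refine ge_of_tendsto' (f := fun n : ℕ => a * (((1 : ℝ) / ((n : ℝ) + 1) : ℝ) : ℂ) + B)
    (x := atTop) ?_ h1
  have h2 := ((Complex.continuous_ofReal.tendsto 0).comp
    (tendsto_one_div_add_atTop_nhds_zero_nat (𝕜 := ℝ))).const_mul a |>.add_const B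
  simpa [Function.comp_def] using h2

section Sampling

variable {E : Type*} [MeasurableSpace E]

lemma map_pair_pi {N : ℕ} (ρ : Measure E) [IsProbabilityMeasure ρ] {i j : Fin N} (hij : i ≠ j) :
    (Measure.pi fun _ : Fin N => ρ).map (fun z => (z i, z j)) = ρ.prod ρ := by
  have h := iIndepFun_pi (μ := fun _ : Fin N => ρ) (X := fun _ => id) (fun _ => aemeasurable_id)
  have h2 := (indepFun_iff_map_prod_eq_prod_map_map (measurable_pi_apply i).aemeasurable
    (measurable_pi_apply j).aemeasurable).1 (h.indepFun hij)
  have h3 : ∀ k : Fin N, (Measure.pi fun _ : Fin N => ρ).map (fun z => z k) = ρ :=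
    fun k => (measurePreserving_eval (fun _ : Fin N => ρ) k).map_eq
  simpa [h3] using h2

/-- The integral form of positive definiteness. For `N` independent points with law `ρ`, the
expectation of the quadratic form is `N ∫ K (x, x) + N (N - 1) ∫∫ K (x, y)`; as it is nonnegative
for every `N`, so is the double integral. -/
lemma integral_prod_nonneg_of_sum_nonneg (ρ : Measure E) [IsProbabilityMeasure ρ]
    {K : E × E → ℂ} (hKm : Measurable K) {C : ℝ} (hKb : ∀ p, ‖K p‖ ≤ C)
    (hK : ∀ (N : ℕ) (z : Fin N → E), 0 ≤ ∑ i, ∑ j, K (z i, z j)) :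
    0 ≤ ∫ p, K p ∂(ρ.prod ρ) := by
  apply nonneg_of_forall_nat (a := ∫ x, K (x, x) ∂ρ)
  intro N
  let π := Measure.pi fun _ : Fin N => ρ
  have hint : ∀ i j : Fin N, Integrable (fun z : Fin N → E => K (z i, z j)) π := fun i j =>
    Integrable.of_bound (Measurable.aestronglyMeasurable (by fun_prop)) C
      (ae_of_all _ fun z => hKb _)
  have hdiag : ∀ i : Fin N, ∫ z, K (z i, z i) ∂π = ∫ x, K (x, x) ∂ρ := by
    intro i
    have h := (measurePreserving_eval (fun _ : Fin N => ρ) i).map_eq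
    conv_rhs => rw [← h]
    rw [integral_map (measurable_pi_apply i).aemeasurable
      (Measurable.aestronglyMeasurable (by fun_prop))]
  have hoff : ∀ i j : Fin N, i ≠ j → ∫ z, K (z i, z j) ∂π = ∫ p, K p ∂(ρ.prod ρ) := by
    intro i j hij
    rw [← map_pair_pi ρ hij, integral_map (by fun_prop) hKm.aestronglyMeasurable]
  have hsum : ∫ z, ∑ i, ∑ j, K (z i, z j) ∂π
      = (N : ℂ) * (∫ x, K (x, x) ∂ρ) + (N : ℂ) * ((N : ℂ) - 1) * ∫ p, K p ∂(ρ.prod ρ) := by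
    rw [integral_finsetSum _ fun i _ => integrable_finsetSum _ fun j _ => hint i j]
    have hrow : ∀ i : Fin N, ∫ z, ∑ j, K (z i, z j) ∂π
        = (∫ x, K (x, x) ∂ρ) + ((N : ℂ) - 1) * ∫ p, K p ∂(ρ.prod ρ) := by
      intro i
      rw [integral_finsetSum _ fun j _ => hint i j,
        ← Finset.add_sum_erase _ _ (Finset.mem_univ i), hdiag,
        Finset.sum_congr rfl fun j hj => hoff i j (Finset.ne_of_mem_erase hj).symm,
        Finset.sum_const, Finset.card_erase_of_mem (Finset.mem_univ i), Finset.card_univ,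
        Fintype.card_fin, nsmul_eq_mul, Nat.cast_sub (Nat.one_le_of_lt i.2), Nat.cast_one]
    rw [Finset.sum_congr rfl fun i _ => hrow i, Finset.sum_const, Finset.card_univ,
      Fintype.card_fin, nsmul_eq_mul]
    ring
  rw [← hsum]
  exact integral_nonneg fun z => hK N z

end Sampling

/-! ### Bochner's theorem with a Gaussian factor -/

section Bochner

open scoped FourierTransform RealInnerProductSpace Real

variable {E : Type*} [NormedAddCommGroup E] [InnerProductSpace ℝ E] [FiniteDimensional ℝ E]
  [MeasurableSpace E] [BorelSpace E] {f : E → ℂ}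

lemma integrable_exp_neg_mul_sq_norm {b : ℝ} (hb : 0 < b) :
    Integrable (fun v : E => Real.exp (-b * ‖v‖ ^ 2)) := by
  have h := (GaussianFourier.integrable_cexp_neg_mul_sq_norm_add (b := (b : ℂ)) (by simpa) 0
    (0 : E)).re
  convert h using 2 with v
  have : (-(b : ℂ) * (‖v‖ : ℂ) ^ 2 + 0 * ((⟪(0 : E), v⟫ : ℝ) : ℂ)) =
    ((-b * ‖v‖ ^ 2 : ℝ) : ℂ) := by push_cast; ring
  rw [this, ← Complex.ofReal_exp]
  rfl

/-- The Gaussian probability measure with density `exp (-π ‖x‖ ^ 2)`. -/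
noncomputable def gaussianPi (E : Type*) [NormedAddCommGroup E] [InnerProductSpace ℝ E]
    [FiniteDimensional ℝ E] [MeasurableSpace E] [BorelSpace E] : Measure E :=
  volume.withDensity fun x => ENNReal.ofReal (Real.exp (-π * ‖x‖ ^ 2))

instance : IsProbabilityMeasure (gaussianPi E) where
  measure_univ := by
    rw [gaussianPi, withDensity_apply _ MeasurableSet.univ, Measure.restrict_univ,
      ← ofReal_integral_eq_lintegral_ofReal (integrable_exp_neg_mul_sq_norm Real.pi_pos)
        (ae_of_all _ fun x => (Real.exp_pos _).le),
      GaussianFourier.integral_rexp_neg_mul_sq_norm Real.pi_pos, div_self Real.pi_pos.ne',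
      Real.one_rpow, ENNReal.ofReal_one]

lemma integral_gaussianPi (g : E → ℂ) :
    ∫ x, g x ∂(gaussianPi E) = ∫ x, Real.exp (-π * ‖x‖ ^ 2) • g x := by
  rw [gaussianPi, integral_withDensity_eq_integral_toReal_smul (by fun_prop)
    (ae_of_all _ fun x => ENNReal.ofReal_lt_top)]
  refine integral_congr_ae (ae_of_all _ fun x => ?_)
  simp only [ENNReal.toReal_ofReal (Real.exp_pos _).le]

/-- If `X` and `Y` are independent with law `gaussianPi E`, then the density of `X - Y` is
proportional to `exp (-(π / 2) ‖z‖ ^ 2)`. -/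
lemma integral_prod_gaussianPi_comp_sub {k : E → ℂ} (hk : Continuous k) {C : ℝ}
    (hC : ∀ x, ‖k x‖ ≤ C) :
    ∫ p : E × E, k (p.1 - p.2) ∂((gaussianPi E).prod (gaussianPi E)) =
      ((∫ y : E, Real.exp (-(2 * π) * ‖y‖ ^ 2) : ℝ) : ℂ) *
        ∫ z, Real.exp (-(π / 2) * ‖z‖ ^ 2) • k z := by
  have hγ := integrable_exp_neg_mul_sq_norm (E := E) Real.pi_pos
  let Φ : E × E → ℂ := fun p =>
    (Real.exp (-π * ‖p.1‖ ^ 2) * Real.exp (-π * ‖p.2‖ ^ 2)) • k (p.1 - p.2)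
  have hΦ : Integrable Φ (volume.prod volume) :=
    Integrable.smul_bdd (hγ.mul_prod hγ) C
      (Continuous.aestronglyMeasurable (by fun_prop)) (ae_of_all _ fun p => hC _)
  have hT := measurePreserving_add_prod (volume : Measure E) (volume : Measure E)
  have hK : Integrable (fun p : E × E => k (p.1 - p.2))
      ((gaussianPi E).prod (gaussianPi E)) :=
    Integrable.of_bound (Continuous.aestronglyMeasurable (by fun_prop)) C
      (ae_of_all _ fun p => hC _)
  have h1 : ∫ p : E × E, k (p.1 - p.2) ∂((gaussianPi E).prod (gaussianPi E))
      = ∫ p, Φ p ∂(volume.prod volume) := by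
    rw [integral_prod _ hK, integral_prod _ hΦ, integral_gaussianPi]
    refine integral_congr_ae (ae_of_all _ fun x => ?_)
    simp only [Φ, integral_gaussianPi, mul_smul]
    rw [integral_smul]
  -- Completing the square: `‖z + y‖ ^ 2 + ‖y‖ ^ 2 = 2 ‖y + z / 2‖ ^ 2 + ‖z‖ ^ 2 / 2`.
  have hsq : ∀ z y : E, Φ (z + y, y) =
      Real.exp (-(2 * π) * ‖y + (1 / 2 : ℝ) • z‖ ^ 2) •
        (Real.exp (-(π / 2) * ‖z‖ ^ 2) • k z) := by
    intro z y
    simp only [Φ, add_sub_cancel_right, smul_smul, ← Real.exp_add]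
    congr 2
    rw [norm_add_sq_real, norm_add_sq_real, inner_smul_right, norm_smul, real_inner_comm]
    norm_num
    ring
  rw [h1]
  calc ∫ p, Φ p ∂(volume.prod volume)
      = ∫ p : E × E, Φ (p.1 + p.2, p.2) ∂(volume.prod volume) := by
        conv_lhs => rw [← hT.map_eq]
        rw [integral_map hT.measurable.aemeasurable
          (Continuous.aestronglyMeasurable (by fun_prop))]
    _ = ∫ z, ∫ y, Φ (z + y, y) := integral_prod _ (hT.integrable_comp_of_integrable hΦ)
    _ = ∫ z, ((∫ y : E, Real.exp (-(2 * π) * ‖y‖ ^ 2) : ℝ) : ℂ) *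
          (Real.exp (-(π / 2) * ‖z‖ ^ 2) • k z) := by
        refine integral_congr_ae (ae_of_all _ fun z => ?_)
        simp only [hsq]
        rw [integral_smul_const,
          integral_add_right_eq_self (fun y : E => Real.exp (-(2 * π) * ‖y‖ ^ 2)),
          real_smul]
    _ = _ := integral_const_mul _ _

/-- Multiplying a positive definite function by a Gaussian gives a function whose Fourier transform
is nonnegative: up to a positive factor, `𝓕 h w` is the quadratic form of positive definiteness,
integrated against the weights `exp (-2πi⟪x, w⟫ - π ‖x‖ ^ 2)`. -/
lemma IsPositiveDefinite.fourier_gaussian_smul_nonneg (hf : IsPositiveDefinite f)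
    (he : Function.Even f) (hc : Continuous f) (w : E) :
    0 ≤ 𝓕 (fun z => Real.exp (-(π / 2) * ‖z‖ ^ 2) • f z) w := by
  let k : E → ℂ := fun z => cexp (↑(-2 * π * ⟪z, w⟫) * I) * f z
  have hk : Continuous k := by fun_prop
  have hkb : ∀ z, ‖k z‖ ≤ (f 0).re := fun z => by
    simp only [k]
    rw [norm_mul, norm_exp_ofReal_mul_I, one_mul]
    exact hf.norm_le_of_even he z
  have h1 : 0 ≤ ∫ p : E × E, k (p.1 - p.2) ∂((gaussianPi E).prod (gaussianPi E)) := by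
    refine integral_prod_nonneg_of_sum_nonneg _ (K := fun p : E × E => k (p.1 - p.2))
      (Continuous.measurable (by fun_prop)) (fun p => hkb _) fun N z => ?_
    convert hf N z (fun i => cexp (↑(-2 * π * ⟪z i, w⟫) * I)) using 5 with i _ j _
    simp only [← Complex.exp_conj, ← Complex.exp_add, map_mul, conj_ofReal, conj_I,
      inner_sub_left]
    congr 1
    push_cast
    ring
  rw [integral_prod_gaussianPi_comp_sub hk hkb] at h1
  have hpos : 0 < ∫ y : E, Real.exp (-(2 * π) * ‖y‖ ^ 2) := by
    rw [GaussianFourier.integral_rexp_neg_mul_sq_norm (by positivity)]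
    positivity
  have h2 : 𝓕 (fun z => Real.exp (-(π / 2) * ‖z‖ ^ 2) • f z) w =
      ∫ z, Real.exp (-(π / 2) * ‖z‖ ^ 2) • k z := by
    rw [Real.fourier_eq']
    refine integral_congr_ae (ae_of_all _ fun z => ?_)
    simp only [k, real_smul, smul_eq_mul]
    ring
  rw [h2]
  have h3 := mul_nonneg (Complex.zero_le_real.2 (inv_nonneg.2 hpos.le)) h1
  rwa [← mul_assoc, ← ofReal_mul, inv_mul_cancel₀ hpos.ne', ofReal_one, one_mul] at h3

/-- A nonnegative Fourier transform is integrable: its integrals against Gaussians tending to `1`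
converge to `h 0`, so Fatou's lemma bounds its integral by `h 0`. -/
lemma integrable_fourier_of_nonneg {h : E → ℂ} (hi : Integrable h) (hc : Continuous h)
    (hn : ∀ w, 0 ≤ 𝓕 h w) : Integrable (𝓕 h) := by
  have hFc : Continuous (𝓕 h) := by
    exact VectorFourier.fourierIntegral_continuous Real.continuous_fourierChar
      (L := innerₗ E) continuous_inner hi
  have hFb : ∀ w, ‖𝓕 h w‖ ≤ ∫ v, ‖h v‖ := fun w =>
    VectorFourier.norm_fourierIntegral_le_integral_norm _ _ _ _ _
  have hre : ∀ w, 𝓕 h w = (((𝓕 h w).re : ℝ) : ℂ) := fun w =>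
    Complex.ext rfl (Complex.nonneg_iff.1 (hn w)).2.symm
  let G : ℕ → E → ℝ := fun n w => Real.exp (-((n : ℝ) + 1)⁻¹ * ‖w‖ ^ 2) * (𝓕 h w).re
  have hGi : ∀ n, Integrable (G n) := fun n =>
    Integrable.smul_bdd (integrable_exp_neg_mul_sq_norm
      (by positivity : 0 < ((n : ℝ) + 1)⁻¹)) (∫ v, ‖h v‖)
      (Complex.continuous_re.comp hFc).aestronglyMeasurable
      (ae_of_all _ fun w => (Complex.abs_re_le_norm _).trans (hFb w))
  have hGn : ∀ n w, 0 ≤ G n w := fun n w =>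
    mul_nonneg (Real.exp_pos _).le (Complex.nonneg_iff.1 (hn w)).1
  have hlim : Tendsto (fun n => ∫ w, G n w) atTop (𝓝 (h 0).re) := by
    have h1 := Real.tendsto_integral_gaussian_smul' hi hc.continuousAt (v := (0 : E))
    have h2 := (Complex.continuous_re.tendsto _).comp
      (h1.comp (tendsto_natCast_atTop_atTop.atTop_add (tendsto_const_nhds (x := (1 : ℝ)))))
    refine h2.congr fun n => ?_
    have hpos : (0 : ℝ) < (n : ℝ) + 1 := by positivity
    have hb : 0 < ((((n : ℝ) + 1)⁻¹ : ℝ) : ℂ).re := by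
      rw [ofReal_re]
      positivity
    have hgi : Integrable (fun w : E => cexp (-((((n : ℝ) + 1)⁻¹ : ℝ) : ℂ) * ‖w‖ ^ 2)) := by
      simpa using GaussianFourier.integrable_cexp_neg_mul_sq_norm_add hb 0 (0 : E)
    have h3 := VectorFourier.integral_fourierIntegral_smul_eq_flip (L := innerₗ E)
      Real.continuous_fourierChar continuous_inner hgi hi (μ := volume) (ν := volume)
    have h4 : ∀ w, VectorFourier.fourierIntegral 𝐞 volume (innerₗ E)
        (fun w : E => cexp (-((((n : ℝ) + 1)⁻¹ : ℝ) : ℂ) * ‖w‖ ^ 2)) w =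
        (π * (((n : ℝ) + 1 : ℝ) : ℂ)) ^ (Module.finrank ℝ E / 2 : ℂ) *
          cexp (-π ^ 2 * (((n : ℝ) + 1 : ℝ) : ℂ) * ‖0 - w‖ ^ 2) := by
      intro w
      refine (fourier_gaussian_innerProductSpace hb w).trans ?_
      congr 1
      · rw [ofReal_inv, div_inv_eq_mul]
      · rw [ofReal_inv, div_inv_eq_mul, zero_sub, norm_neg]
        ring_nf
    have h5 : VectorFourier.fourierIntegral 𝐞 volume (innerₗ E).flip h = 𝓕 h := by
      rw [flip_innerₗ]
      rfl
    simp only [h4, h5] at h3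
    simp only [Function.comp_apply]
    rw [h3]
    have h6 : ∀ w, cexp (-((((n : ℝ) + 1)⁻¹ : ℝ) : ℂ) * ‖w‖ ^ 2) • 𝓕 h w = ((G n w : ℝ) : ℂ) := by
      intro w
      rw [hre w]
      simp [G]
    simp only [h6]
    exact congrArg Complex.re (integral_ofReal (f := G n) (𝕜 := ℂ))
  have hfatou : ∫⁻ w, ENNReal.ofReal (𝓕 h w).re ≤ ENNReal.ofReal (h 0).re := by
    have hpt : ∀ w, Tendsto (fun n => ENNReal.ofReal (G n w)) atTop
        (𝓝 (ENNReal.ofReal (𝓕 h w).re)) := by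
      intro w
      refine ENNReal.tendsto_ofReal ?_
      have h1 : Tendsto (fun n : ℕ => ((n : ℝ) + 1)⁻¹) atTop (𝓝 0) := by
        simpa using tendsto_one_div_add_atTop_nhds_zero_nat (𝕜 := ℝ)
      have h2 := ((Real.continuous_exp.tendsto _).comp
        (h1.neg.mul_const (‖w‖ ^ 2))).mul_const (𝓕 h w).re
      simpa [G, Function.comp_def] using h2
    calc ∫⁻ w, ENNReal.ofReal (𝓕 h w).re
        = ∫⁻ w, liminf (fun n => ENNReal.ofReal (G n w)) atTop :=
          lintegral_congr fun w => (hpt w).liminf_eq.symm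
      _ ≤ liminf (fun n => ∫⁻ w, ENNReal.ofReal (G n w)) atTop :=
          lintegral_liminf_le fun n => Measurable.ennreal_ofReal
            (Continuous.measurable (by fun_prop))
      _ = liminf (fun n => ENNReal.ofReal (∫ w, G n w)) atTop := by
          congr 1
          funext n
          exact (ofReal_integral_eq_lintegral_ofReal (hGi n) (ae_of_all _ (hGn n))).symm
      _ = ENNReal.ofReal (h 0).re := (ENNReal.tendsto_ofReal hlim).liminf_eq
  refine ⟨hFc.aestronglyMeasurable, lt_of_le_of_lt ?_ ENNReal.ofReal_lt_top (b :=
    ENNReal.ofReal (h 0).re)⟩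
  refine le_trans (lintegral_mono fun w => ?_) hfatou
  rw [hre w, ← ofReal_norm, norm_real, Real.norm_of_nonneg
    (Complex.nonneg_iff.1 (hn w)).1, ofReal_re]

/-- A continuous integrable function with nonnegative Fourier transform is the characteristic
function of a finite measure, by Fourier inversion. -/
lemma exists_charFun_eq_of_fourier_nonneg {h : E → ℂ} (hi : Integrable h) (hc : Continuous h)
    (hn : ∀ w, 0 ≤ 𝓕 h w) :
    ∃ μ : Measure E, IsFiniteMeasure μ ∧ ∀ x, charFun μ x = h x := by
  have hFi := integrable_fourier_of_nonneg hi hc hn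
  have hFc : Continuous (𝓕 h) := by
    exact VectorFourier.fourierIntegral_continuous Real.continuous_fourierChar
      (L := innerₗ E) continuous_inner hi
  have hre : ∀ w, 𝓕 h w = (((𝓕 h w).re : ℝ) : ℂ) := fun w =>
    Complex.ext rfl (Complex.nonneg_iff.1 (hn w)).2.symm
  let ν : Measure E := volume.withDensity fun w => ENNReal.ofReal (𝓕 h w).re
  have hν : IsFiniteMeasure ν := isFiniteMeasure_withDensity_ofReal hFi.re.2
  refine ⟨ν.map fun w => (2 * π) • w, inferInstance, fun x => ?_⟩
  rw [charFun_map_smul, charFun_apply, integral_withDensity_eq_integral_toReal_smul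
    (Measurable.ennreal_ofReal (Continuous.measurable (by fun_prop)))
    (ae_of_all _ fun x => ENNReal.ofReal_lt_top)]
  conv_rhs => rw [← hc.fourierInv_fourier_eq hi hFi, Real.fourierInv_eq']
  refine integral_congr_ae (ae_of_all _ fun w => ?_)
  simp only
  rw [ENNReal.toReal_ofReal (Complex.nonneg_iff.1 (hn w)).1, hre w, inner_smul_right, real_smul,
    smul_eq_mul, mul_comm, ofReal_re]

/-- A form of Bochner's theorem: a continuous even positive definite function times a Gaussian of
any width is the characteristic function of a finite measure. -/
lemma IsPositiveDefinite.exists_charFun_eq_gaussian_smul (hf : IsPositiveDefinite f)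
    (he : Function.Even f) (hc : Continuous f) {t : ℝ} (ht : 0 < t) :
    ∃ μ : Measure E, IsFiniteMeasure μ ∧
      ∀ x, charFun μ x = Real.exp (-(π / 2) * ‖t • x‖ ^ 2) • f x := by
  let F : E → ℂ := fun x => f (t⁻¹ • x)
  have hF : IsPositiveDefinite F :=
    hf.comp_addMonoidHom (DistribSMul.toAddMonoidHom E t⁻¹)
  have hFe : Function.Even F := fun x => by simp only [F, smul_neg, he (t⁻¹ • x)]
  have hFc : Continuous F := by fun_prop
  obtain ⟨μ, hμ, h⟩ := exists_charFun_eq_of_fourier_nonneg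
    (Integrable.smul_bdd (integrable_exp_neg_mul_sq_norm (by positivity)) (F 0).re
      hFc.aestronglyMeasurable (ae_of_all _ fun x => hF.norm_le_of_even hFe x))
    (by fun_prop) (hF.fourier_gaussian_smul_nonneg hFe hFc)
  refine ⟨μ.map fun x => t • x, inferInstance, fun x => ?_⟩
  rw [charFun_map_smul, h]
  simp [F, smul_smul, inv_mul_cancel₀ ht.ne']

end Bochner

/-! ### Correlation under a law with real characteristic function -/

section Correlation

open scoped RealInnerProductSpace Real

variable {E : Type*} [NormedAddCommGroup E] [InnerProductSpace ℝ E] [FiniteDimensional ℝ E]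
  [MeasurableSpace E] [BorelSpace E]

/-- The Parseval identity for characteristic functions. -/
lemma integral_charFun_comm (μ ρ : Measure E) [IsFiniteMeasure μ] [IsFiniteMeasure ρ] :
    ∫ y, charFun μ y ∂ρ = ∫ x, charFun ρ x ∂μ := by
  simp only [charFun_apply]
  rw [integral_integral_swap]
  · simp only [real_inner_comm]
  · refine Integrable.of_bound (Continuous.aestronglyMeasurable ?_) 1 (ae_of_all _ fun p => ?_)
    · simp only [Function.uncurry_def]
      fun_prop
    · exact (norm_exp_ofReal_mul_I _).le

/-- The correlation inequality for `f` and `g` that are characteristic functions of measures `μ` and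
`ν`. By Parseval, the two sides are the integrals of `r x * r y` and `r (x + y)` against `μ.prod ν`,
and as `ν` is symmetric, `r (x + y)` may be averaged with `r (x - y)`. -/
lemma integral_mul_integral_le_of_charFun {ρ μ ν : Measure E} [IsProbabilityMeasure ρ]
    [IsFiniteMeasure μ] [IsFiniteMeasure ν] {r : E → ℝ} (hr : ∀ x, charFun ρ x = r x)
    (hrr : ∀ x y, r x * r y ≤ (r (x + y) + r (x - y)) / 2)
    (hν : Function.Even (charFun ν)) :
    (∫ x, charFun μ x ∂ρ) * (∫ x, charFun ν x ∂ρ) ≤ ∫ x, charFun μ x * charFun ν x ∂ρ := by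
  have hrc : Continuous r := by
    have h : r = fun x => (charFun ρ x).re := by
      funext x
      simp [hr]
    rw [h]
    exact Complex.continuous_re.comp continuous_charFun
  have hrb : ∀ x, ‖r x‖ ≤ 1 := fun x => by
    simpa [hr] using norm_charFun_le_one (μ := ρ) x
  have hri : ∀ (m : Measure E) [IsFiniteMeasure m], Integrable r m := fun m _ =>
    Integrable.of_bound hrc.aestronglyMeasurable 1 (ae_of_all _ hrb)
  have hri2 : ∀ L : E × E → E, Continuous L → Integrable (fun x => r (L x)) (μ.prod ν) :=
    fun L hL =>
    Integrable.of_bound (hrc.comp hL).aestronglyMeasurable 1 (ae_of_all _ fun x => hrb _)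
  have hsymm : ν.map (fun y => (-1 : ℝ) • y) = ν := by
    refine Measure.ext_of_charFun (funext fun x => ?_)
    rw [charFun_map_smul, neg_one_smul, hν]
  have hcast : ∀ (m : Measure E) [IsFiniteMeasure m],
      ∫ x, charFun m x ∂ρ = ((∫ x, r x ∂m : ℝ) : ℂ) := by
    intro m _
    rw [integral_charFun_comm]
    simp only [hr]
    exact integral_ofReal
  have hadd : ∫ z, r z ∂(μ ∗ ν) = ∫ p, r (p.1 + p.2) ∂(μ.prod ν) := by
    rw [integral_conv (hri _), integral_prod _ (hri2 _ (by fun_prop))]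
  have hsub : ∫ z, r z ∂(μ ∗ ν) = ∫ p, r (p.1 - p.2) ∂(μ.prod ν) := by
    rw [integral_conv (hri _), integral_prod _ (hri2 _ (by fun_prop))]
    refine integral_congr_ae (ae_of_all _ fun x => ?_)
    simp only
    conv_lhs => rw [← hsymm]
    rw [integral_map (by fun_prop) (Continuous.aestronglyMeasurable (by fun_prop))]
    simp only [neg_one_smul, sub_eq_add_neg]
  have hL : (∫ x, r x ∂μ) * (∫ y, r y ∂ν) = ∫ p, r p.1 * r p.2 ∂(μ.prod ν) :=
    (integral_prod_mul r r).symm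
  simp only [← charFun_conv]
  rw [hcast μ, hcast ν, hcast (μ ∗ ν), ← ofReal_mul, Complex.real_le_real, hL]
  have hR : ∫ z, r z ∂(μ ∗ ν) = ∫ p, (r (p.1 + p.2) + r (p.1 - p.2)) / 2 ∂(μ.prod ν) := by
    rw [integral_div, integral_add (hri2 _ (by fun_prop)) (hri2 _ (by fun_prop)), ← hadd, ← hsub]
    ring
  rw [hR]
  exact integral_mono ((hri μ).mul_prod (hri ν))
    (((hri2 _ (by fun_prop)).add (hri2 _ (by fun_prop))).div_const 2) fun p => hrr _ _

/-- Continuous even positive definite functions are non-negatively correlated under a law whose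
characteristic function `r` is real with `r x * r y ≤ (r (x + y) + r (x - y)) / 2`. -/
lemma IsPositiveDefinite.integral_mul_integral_le {ρ : Measure E} [IsProbabilityMeasure ρ]
    {r : E → ℝ} (hr : ∀ x, charFun ρ x = r x)
    (hrr : ∀ x y, r x * r y ≤ (r (x + y) + r (x - y)) / 2) {f g : E → ℂ}
    (hf : IsPositiveDefinite f) (hfe : Function.Even f) (hfc : Continuous f)
    (hg : IsPositiveDefinite g) (hge : Function.Even g) (hgc : Continuous g) :
    (∫ x, f x ∂ρ) * (∫ x, g x ∂ρ) ≤ ∫ x, f x * g x ∂ρ := by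
  -- The Gaussian cutoffs `w n` increase to `1` pointwise.
  let w : ℕ → E → ℝ := fun n x => Real.exp (-(π / 2) * ‖((1 : ℝ) / ((n : ℝ) + 1)) • x‖ ^ 2)
  have hwc : ∀ n, Continuous (w n) := fun n => by fun_prop
  have hw1 : ∀ n x, ‖w n x‖ ≤ 1 := fun n x => by
    rw [Real.norm_of_nonneg (Real.exp_pos _).le, Real.exp_le_one_iff]
    exact mul_nonpos_of_nonpos_of_nonneg (by linarith [Real.pi_pos]) (by positivity)
  have hwt : ∀ x, Tendsto (fun n => w n x) atTop (𝓝 1) := by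
    intro x
    have hcont : Continuous fun t : ℝ => Real.exp (-(π / 2) * ‖t • x‖ ^ 2) := by fun_prop
    simpa [w, Function.comp_def] using (hcont.tendsto 0).comp
      (tendsto_one_div_add_atTop_nhds_zero_nat (𝕜 := ℝ))
  have hfb := hf.norm_le_of_even hfe
  have hgb := hg.norm_le_of_even hge
  have hlim : ∀ {u : E → ℂ} {C : ℝ}, Continuous u → (∀ x, ‖u x‖ ≤ C) →
      Tendsto (fun n => ∫ x, w n x • u x ∂ρ) atTop (𝓝 (∫ x, u x ∂ρ)) := by
    intro u C huc hub
    refine tendsto_integral_of_dominated_convergence (fun _ => C)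
      (fun n => Continuous.aestronglyMeasurable (by fun_prop)) (integrable_const _)
      (fun n => ae_of_all _ fun x => ?_) (ae_of_all _ fun x => ?_)
    · rw [norm_smul]
      exact (mul_le_of_le_one_left (norm_nonneg _) (hw1 n x)).trans (hub x)
    · simpa using (hwt x).smul_const (u x)
  have hlim2 : Tendsto (fun n => ∫ x, (w n x • f x) * (w n x • g x) ∂ρ) atTop
      (𝓝 (∫ x, f x * g x ∂ρ)) := by
    refine tendsto_integral_of_dominated_convergence (fun _ => (f 0).re * (g 0).re)
      (fun n => Continuous.aestronglyMeasurable (by fun_prop)) (integrable_const _)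
      (fun n => ae_of_all _ fun x => ?_) (ae_of_all _ fun x => ?_)
    · rw [norm_mul, norm_smul, norm_smul]
      exact mul_le_mul ((mul_le_of_le_one_left (norm_nonneg _) (hw1 n x)).trans (hfb x))
        ((mul_le_of_le_one_left (norm_nonneg _) (hw1 n x)).trans (hgb x)) (by positivity)
        ((norm_nonneg _).trans (hfb x))
    · simpa using ((hwt x).smul_const (f x)).mul ((hwt x).smul_const (g x))
  refine le_of_tendsto_of_tendsto' ((hlim hfc hfb).mul (hlim hgc hgb)) hlim2 fun n => ?_
  obtain ⟨μ, hμ, hμf⟩ := hf.exists_charFun_eq_gaussian_smul hfe hfc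
    (t := (1 : ℝ) / ((n : ℝ) + 1)) (by positivity)
  obtain ⟨ν, hν, hνg⟩ := hg.exists_charFun_eq_gaussian_smul hge hgc
    (t := (1 : ℝ) / ((n : ℝ) + 1)) (by positivity)
  have h := integral_mul_integral_le_of_charFun (μ := μ) (ν := ν) hr hrr
    (fun x => by rw [hνg, hνg, hge x, smul_neg, norm_neg])
  simpa only [hμf, hνg] using h

end Correlation

/-! ### The characteristic function of a stable vector -/

section Stable

/-- A two-point Clarkson inequality: with `p = q / 2 ≤ 1`, concavity of `t ↦ t ^ p` at
`(a + b) ^ 2` and `(a - b) ^ 2` bounds half of the left side by `(a ^ 2 + b ^ 2) ^ p`, and `t ↦ t ^ p`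
is subadditive. -/
lemma abs_add_rpow_add_abs_sub_rpow_le {q : ℝ} (hq0 : 0 < q) (hq2 : q ≤ 2) (a b : ℝ) :
    |a + b| ^ q + |a - b| ^ q ≤ 2 * |a| ^ q + 2 * |b| ^ q := by
  have hsq : ∀ x : ℝ, |x| ^ q = (x ^ 2) ^ (q / 2) := by
    intro x
    rw [← sq_abs, ← Real.rpow_natCast_mul (abs_nonneg x)]
    congr 1
    push_cast
    ring
  have hp0 : 0 ≤ q / 2 := by positivity
  have hp1 : q / 2 ≤ 1 := by linarith
  have h1 := (Real.concaveOn_rpow hp0 hp1).2 (Set.mem_Ici.2 (sq_nonneg (a + b)))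
    (Set.mem_Ici.2 (sq_nonneg (a - b))) (show (0 : ℝ) ≤ 1 / 2 by norm_num)
    (show (0 : ℝ) ≤ 1 / 2 by norm_num) (by norm_num)
  have h2 := Real.rpow_add_le_add_rpow (sq_nonneg a) (sq_nonneg b) hp0 hp1
  simp only [smul_eq_mul] at h1
  have h3 : 1 / 2 * (a + b) ^ 2 + 1 / 2 * (a - b) ^ 2 = a ^ 2 + b ^ 2 := by ring
  rw [h3] at h1
  simp only [hsq]
  linarith

variable {q : ℝ}

lemma LqUnitInterval.integrable_abs_rpow (hq0 : 0 < q) (s : LqUnitInterval q) :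
    Integrable (fun t => |s t| ^ q) (volume.restrict (Set.Icc (0 : ℝ) 1)) := by
  have h := (Lp.memLp s).integrable_norm_rpow (ENNReal.ofReal_pos.2 hq0).ne' ENNReal.ofReal_ne_top
  simpa [ENNReal.toReal_ofReal hq0.le] using h

lemma LqUnitInterval.norm_rpow_eq (hq0 : 0 < q) (s : LqUnitInterval q) :
    ‖s‖ ^ q = ∫ t in Set.Icc (0 : ℝ) 1, |s t| ^ q := by
  have h0 : 0 ≤ ∫ t in Set.Icc (0 : ℝ) 1, |s t| ^ q :=
    integral_nonneg fun t => Real.rpow_nonneg (abs_nonneg _) _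
  rw [Lp.norm_def, (Lp.memLp s).eLpNorm_eq_integral_rpow_norm (ENNReal.ofReal_pos.2 hq0).ne'
    ENNReal.ofReal_ne_top, ENNReal.toReal_ofReal hq0.le]
  simp only [Real.norm_eq_abs]
  rw [ENNReal.toReal_ofReal (Real.rpow_nonneg h0 _), Real.rpow_inv_rpow h0 hq0.ne']

lemma LqUnitInterval.norm_add_rpow_add_norm_sub_rpow_le (hq0 : 0 < q) (hq2 : q ≤ 2)
    (a b : LqUnitInterval q) :
    ‖a + b‖ ^ q + ‖a - b‖ ^ q ≤ 2 * ‖a‖ ^ q + 2 * ‖b‖ ^ q := by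
  have hi := LqUnitInterval.integrable_abs_rpow (q := q) hq0
  simp only [LqUnitInterval.norm_rpow_eq hq0]
  rw [← integral_add (hi _) (hi _), ← integral_const_mul, ← integral_const_mul,
    ← integral_add ((hi _).const_mul _) ((hi _).const_mul _)]
  refine integral_mono_ae ((hi _).add (hi _)) (((hi _).const_mul _).add ((hi _).const_mul _)) ?_
  filter_upwards [Lp.coeFn_add a b, Lp.coeFn_sub a b] with t h1 h2
  simp only [h1, h2, Pi.add_apply, Pi.sub_apply]
  exact abs_add_rpow_add_abs_sub_rpow_le hq0 hq2 _ _

lemma exp_neg_mul_exp_neg_le {ψx ψy A B : ℝ} (h : A + B ≤ 2 * ψx + 2 * ψy) :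
    Real.exp (-ψx) * Real.exp (-ψy) ≤ (Real.exp (-A) + Real.exp (-B)) / 2 := by
  have hA : Real.exp (-A) = Real.exp (-A / 2) ^ 2 := by
    rw [← Real.exp_nat_mul]
    congr 1
    push_cast
    ring
  have hB : Real.exp (-B) = Real.exp (-B / 2) ^ 2 := by
    rw [← Real.exp_nat_mul]
    congr 1
    push_cast
    ring
  calc Real.exp (-ψx) * Real.exp (-ψy) = Real.exp (-ψx + -ψy) := (Real.exp_add _ _).symm
    _ ≤ Real.exp (-A / 2 + -B / 2) := Real.exp_le_exp.2 (by linarith)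
    _ = Real.exp (-A / 2) * Real.exp (-B / 2) := Real.exp_add _ _
    _ ≤ (Real.exp (-A) + Real.exp (-B)) / 2 := by
      rw [hA, hB]
      linarith [two_mul_le_add_sq (Real.exp (-A / 2)) (Real.exp (-B / 2))]

end Stable

end StableCorrelation

theorem theorem1 {Ω : Type*} [MeasurableSpace Ω] (P : Measure Ω) [IsProbabilityMeasure P]
    (q : ℝ) (hq0 : 0 < q) (hq2 : q ≤ 2)
    (k : ℕ) (X : Fin k → Ω → ℝ) (hX : StableCorrelation.IsJointlySymmStable q P X)
    (m : ℕ) (hmk : m < k)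
    (f : (Fin m → ℝ) → ℂ) (g : (Fin (k - m) → ℝ) → ℂ)
    (hf_even : Function.Even f) (hf_cont : Continuous f)
    (hf_pd : StableCorrelation.IsPositiveDefinite f)
    (hg_even : Function.Even g) (hg_cont : Continuous g)
    (hg_pd : StableCorrelation.IsPositiveDefinite g) :
    Integrable (fun ω => f (StableCorrelation.firstBlock hmk X ω)) P ∧
    Integrable (fun ω => g (StableCorrelation.lastBlock hmk X ω)) P ∧
    Integrable (fun ω => f (StableCorrelation.firstBlock hmk X ω) *
      g (StableCorrelation.lastBlock hmk X ω)) P ∧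
    (∫ ω, f (StableCorrelation.firstBlock hmk X ω) *
        g (StableCorrelation.lastBlock hmk X ω) ∂P) ≥
      (∫ ω, f (StableCorrelation.firstBlock hmk X ω) ∂P) *
        (∫ ω, g (StableCorrelation.lastBlock hmk X ω) ∂P) := by
  open StableCorrelation in
  obtain ⟨n, Y, ξ, ⟨hY, s, hs⟩, hXY⟩ := hX
  let E := EuclideanSpace ℝ (Fin n)
  let A : E →ₗ[ℝ] Fin m → ℝ := LinearMap.pi fun i => innerₗ E (ξ (Fin.castLE hmk.le i))
  let B : E →ₗ[ℝ] Fin (k - m) → ℝ := LinearMap.pi fun j => innerₗ E (ξ ⟨m + j, by omega⟩)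
  have hA : ∀ᵐ ω ∂P, firstBlock hmk X ω = A (Y ω) := by
    filter_upwards [ae_all_iff.2 hXY] with ω hω
    funext i
    simp [A, firstBlock, hω, real_inner_comm]
  have hB : ∀ᵐ ω ∂P, lastBlock hmk X ω = B (Y ω) := by
    filter_upwards [ae_all_iff.2 hXY] with ω hω
    funext j
    simp [B, lastBlock, hω, real_inner_comm]
  have hAc : Continuous A := A.continuous_of_finiteDimensional
  have hBc : Continuous B := B.continuous_of_finiteDimensional
  have hF := hf_pd.comp_addMonoidHom A.toAddMonoidHom
  have hG := hg_pd.comp_addMonoidHom B.toAddMonoidHom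
  have hFe : Function.Even fun x : E => f (A x) := fun x => by simp only [map_neg, hf_even (A x)]
  have hGe : Function.Even fun x : E => g (B x) := fun x => by simp only [map_neg, hg_even (B x)]
  have hFc : Continuous fun x : E => f (A x) := hf_cont.comp hAc
  have hGc : Continuous fun x : E => g (B x) := hg_cont.comp hBc
  have hfY : (fun ω => f (firstBlock hmk X ω)) =ᵐ[P] fun ω => f (A (Y ω)) := by
    filter_upwards [hA] with ω hω
    rw [hω]
  have hgY : (fun ω => g (lastBlock hmk X ω)) =ᵐ[P] fun ω => g (B (Y ω)) := by
    filter_upwards [hB] with ω hω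
    rw [hω]
  have hfi : Integrable (fun ω => f (firstBlock hmk X ω)) P :=
    (integrable_congr hfY).2 (Integrable.of_bound
      (hFc.measurable.comp_aemeasurable hY).aestronglyMeasurable (f 0).re
      (ae_of_all _ fun ω => hf_pd.norm_le_of_even hf_even _))
  have hgi : Integrable (fun ω => g (lastBlock hmk X ω)) P :=
    (integrable_congr hgY).2 (Integrable.of_bound
      (hGc.measurable.comp_aemeasurable hY).aestronglyMeasurable (g 0).re
      (ae_of_all _ fun ω => hg_pd.norm_le_of_even hg_even _))
  refine ⟨hfi, hgi, hfi.mul_bdd hgi.aestronglyMeasurable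
    (ae_of_all _ fun ω => hg_pd.norm_le_of_even hg_even _), ?_⟩
  have hρ : IsProbabilityMeasure (P.map Y) := Measure.isProbabilityMeasure_map hY
  have key := hF.integral_mul_integral_le hs (fun x y => exp_neg_mul_exp_neg_le (by
    simpa only [PiLp.add_apply, PiLp.sub_apply, add_smul, sub_smul, Finset.sum_add_distrib,
      Finset.sum_sub_distrib] using LqUnitInterval.norm_add_rpow_add_norm_sub_rpow_le hq0 hq2
        (∑ i, x i • s i) (∑ i, y i • s i))) hFe hFc hG hGe hGc
  have hfgY : (fun ω => f (firstBlock hmk X ω) * g (lastBlock hmk X ω)) =ᵐ[P]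
      fun ω => f (A (Y ω)) * g (B (Y ω)) := hfY.mul hgY
  rw [integral_congr_ae hfY, integral_congr_ae hgY, integral_congr_ae hfgY]
  have hmap : ∀ u : E → ℂ, Continuous u → ∫ x, u x ∂(P.map Y) = ∫ ω, u (Y ω) ∂P :=
    fun u hu => integral_map hY hu.aestronglyMeasurable
  have h1 := hmap _ hFc
  have h2 := hmap _ hGc
  have h3 := hmap _ (hFc.mul hGc)
  rw [ge_iff_le, ← h1, ← h2]
  exact key.trans_eq h3
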